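/- Let $p$ be a prime with $p \equiv 1 \pmod{30}$, let $A_5$ be the alternating group on five letters, and let $\mathbb{Z}_p$ be the cyclic group of order $p$. Then every connected Cayley graph on the direct product $A_5 \times \mathbb{Z}_p$ has a hamiltonian cycle. Here, for a finite group $G$ and a subset $S \subseteq G$, the Cayley graph $\mathrm{Cay}(G;S)$ is the graph whose vertices are the elements of $G$, with an edge joining $g$ to $gs$ and an edge joining $g$ to $gs^{-1}$ for each $g \in G$ and $s \in S$; a hamiltonian cycle is a cycle that visits every vertex exactly once. -/

import Mathlib

/-!
A Hamiltonian cycle of a Cayley graph of `A₅` is a word in the first components of the connection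
set. The product of the second components of its letters is an element `ζ` of `ℤ_p`. If `ζ ≠ 1`,
then it generates `ℤ_p`, and the word repeated `p` times is a Hamiltonian cycle of the product.
As `ℤ_p` is abelian, `ζ` depends only on the exponent sums of the word. Hence, if the exponent sums
of all Hamiltonian words span a lattice that contains a multiple of a basis vector, by a factor
prime to `p`, then some word has `ζ ≠ 1` as soon as the second component for that basis vector is
nontrivial.

Choose an element `(s, ζ)` of the connection set with `ζ ≠ 1`. For `s ≠ 1` one may assume that `s`
is `(0 1 2 3 4)`, `(0 1 2)` or `(0 1)(2 3)`, up to conjugation in `S₅`. Since the first components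
generate `A₅`, one or two of them can be chosen such that explicit Hamiltonian words in `s` and the
chosen elements produce the required lattice vector. The only exception is a `3`-cycle `s` with an
involution `t` whose second component is trivial. Then a word in blocks `s² t` and `s⁻² t` yields a
sequence of cosets of the subgroup generated by `(s, ζ)`, which are traversed one after the other.
For `s = 1` the cosets of `1 × ℤ_p` are traversed in the same way.
-/

section CayleyGraphs

theorem exists_walk_support_eq_map_range {V : Type*} {Γ : SimpleGraph V} {n : ℕ} (f : ℕ → V)
    (hadj : ∀ i < n, Γ.Adj (f i) (f (i + 1))) :
    ∃ p : Γ.Walk (f 0) (f n), p.support = (List.range (n + 1)).map f := by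
  induction n with
  | zero => exact ⟨.nil, rfl⟩
  | succ n ih =>
    obtain ⟨p, hp⟩ := ih fun i hi => hadj i (by lia)
    exact ⟨p.concat (hadj n n.lt_succ_self), by
      rw [SimpleGraph.Walk.support_concat, hp, List.range_succ (n := n + 1), List.map_append]
      rfl⟩

theorem isHamiltonian_of_closed_enumeration {V : Type*} [Fintype V] [DecidableEq V]
    {Γ : SimpleGraph V} {n : ℕ} (hn : 3 ≤ n) (hcard : Fintype.card V = n) (f : ℕ → V)
    (hinj : Set.InjOn f (Set.Iio n)) (hadj : ∀ i < n, Γ.Adj (f i) (f (i + 1)))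
    (hclosed : f n = f 0) : Γ.IsHamiltonian := by
  obtain ⟨m, rfl⟩ : ∃ m, n = m + 1 := ⟨n - 1, by lia⟩
  obtain ⟨p, hp⟩ := exists_walk_support_eq_map_range f fun i (hi : i < m) => hadj i (by lia)
  have hpath : p.IsPath := .mk' <| hp ▸ List.nodup_range.map_on fun i hi j hj =>
    hinj (List.mem_range.1 hi) (List.mem_range.1 hj)
  have hlength : p.length = m := by simpa using congrArg List.length hp
  have hlast : Γ.Adj (f m) (f 0) := hclosed ▸ hadj m m.lt_succ_self
  refine fun _ => ⟨_, .cons hlast p,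
    SimpleGraph.Walk.isHamiltonianCycle_iff_isCycle_and_length_eq.2 ⟨?_, by simp [hlength, hcard]⟩⟩
  refine (SimpleGraph.Walk.cons_isCycle_iff ..).2 ⟨hpath, fun he => ?_⟩
  have := hpath.length_eq_one_of_mem_edges (Sym2.eq_swap ▸ he)
  lia

variable {G : Type*} [Group G] {S : Set G}

theorem inv_mul_mem_closure_of_walk {u v : G} (p : (SimpleGraph.mulCayley S).Walk u v) :
    u⁻¹ * v ∈ Subgroup.closure S := by
  induction p with
  | nil => simp
  | @cons u v w hadj _ ih =>
    have hstep : u⁻¹ * v ∈ Subgroup.closure S := by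
      rcases ((SimpleGraph.mulCayley_adj ..).1 hadj).2 with h | h
      · exact Subgroup.subset_closure h
      · simpa using inv_mem (Subgroup.subset_closure h)
    simpa [mul_assoc] using mul_mem hstep ih

theorem closure_eq_top_of_mulCayley_connected (hS : (SimpleGraph.mulCayley S).Connected) :
    Subgroup.closure S = ⊤ := by
  refine (Subgroup.eq_top_iff' _).2 fun g => ?_
  obtain ⟨p⟩ := hS.preconnected 1 g
  simpa using inv_mul_mem_closure_of_walk p

variable [Fintype G] [DecidableEq G]

theorem mulCayley_isHamiltonian_of_closed_enumeration {n : ℕ} (hn : 3 ≤ n)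
    (hcard : Fintype.card G = n) (f : ℕ → G) (hinj : Set.InjOn f (Set.Iio n))
    (hstep : ∀ i < n, (f i)⁻¹ * f (i + 1) ∈ S ∪ S⁻¹) (hclosed : f n = f 0) :
    (SimpleGraph.mulCayley S).IsHamiltonian := by
  have hne : ∀ i < n, f i ≠ f (i + 1) := fun i hi heq => by
    rcases (Order.add_one_le_of_lt hi).lt_or_eq with h | h
    · exact i.lt_succ_self.ne (hinj hi h heq)
    · have : i = 0 := hinj hi (Nat.zero_lt_of_lt hi) (by rw [heq, ← hclosed, ← h])
      lia
  refine isHamiltonian_of_closed_enumeration hn hcard f hinj (fun i hi => ?_) hclosed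
  refine (SimpleGraph.mulCayley_adj ..).2 ⟨hne i hi, ?_⟩
  simpa using hstep i hi

theorem mulCayley_isHamiltonian_of_rows {m n : ℕ} (hmn : 3 ≤ m * n)
    (hcard : Fintype.card G = m * n) (f : ℕ → ℕ → G)
    (hinj : ∀ i < m, ∀ r < n, ∀ i' < m, ∀ r' < n, f i r = f i' r' → i = i' ∧ r = r')
    (hrow : ∀ i < m, ∀ r, r + 1 < n → (f i r)⁻¹ * f i (r + 1) ∈ S ∪ S⁻¹)
    (hturn : ∀ i < m, ∀ r, r + 1 = n → (f i r)⁻¹ * f (i + 1) 0 ∈ S ∪ S⁻¹)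
    (hclosed : f m 0 = f 0 0) : (SimpleGraph.mulCayley S).IsHamiltonian := by
  have hn : 0 < n := Nat.pos_of_ne_zero fun h => by simp [h] at hmn
  have hrows : ∀ k < m * n, k / n < m ∧ k % n < n := fun k hk =>
    ⟨Nat.div_lt_of_lt_mul (mul_comm m n ▸ hk), k.mod_lt hn⟩
  let traverse (k : ℕ) : G := f (k / n) (k % n)
  have traverse_add {i r : ℕ} (hr : r < n) : traverse (r + n * i) = f i r := by
    simp [traverse, Nat.add_mul_div_left _ _ hn, Nat.div_eq_of_lt hr, Nat.mod_eq_of_lt hr]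
  have traverse_end (i : ℕ) : traverse (n + n * i) = f (i + 1) 0 := by
    rw [← traverse_add hn, zero_add, Nat.mul_succ, add_comm]
  refine mulCayley_isHamiltonian_of_closed_enumeration hmn hcard traverse
    (fun k hk l hl heq => ?_) (fun k hk => ?_) ?_
  · obtain ⟨hkq, hkr⟩ := hrows k hk
    obtain ⟨hlq, hlr⟩ := hrows l hl
    obtain ⟨hquot, hrem⟩ := hinj _ hkq _ hkr _ hlq _ hlr heq
    rw [← Nat.div_add_mod k n, hquot, hrem, Nat.div_add_mod]
  · obtain ⟨hq, hr⟩ := hrows k hk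
    rw [← Nat.mod_add_div k n, traverse_add hr, add_right_comm]
    rcases (Order.add_one_le_of_lt hr).lt_or_eq with h | h
    · rw [traverse_add h]
      exact hrow _ hq _ h
    · rw [h, traverse_end]
      exact hturn _ hq _ h
  · simpa [traverse, hn] using hclosed

theorem mulCayley_isHamiltonian_of_cosets {K : Subgroup G} {m : ℕ}
    (hcard : Fintype.card G = m * Nat.card K) (hthree : 3 ≤ Fintype.card G) (c t Q : ℕ → G)
    (hcS : ∀ i < m, c i ∈ S ∪ S⁻¹) (hcK : ∀ i < m, Subgroup.zpowers (c i) = K)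
    (htS : ∀ i < m, t i ∈ S ∪ S⁻¹) (hQ : ∀ i < m, Q (i + 1) = Q i * (c i)⁻¹ * t i)
    (hcosets : ∀ i < m, ∀ j < m, (Q i)⁻¹ * Q j ∈ K → i = j) (hclosed : Q m = Q 0) :
    (SimpleGraph.mulCayley S).IsHamiltonian := by
  have hpow {i : ℕ} (hi : i < m) (r : ℕ) : c i ^ r ∈ K := hcK i hi ▸ Subgroup.npow_mem_zpowers _ r
  have horder {i : ℕ} (hi : i < m) : orderOf (c i) = Nat.card K := by
    rw [← hcK i hi, Nat.card_zpowers]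
  refine mulCayley_isHamiltonian_of_rows (hcard ▸ hthree) hcard (fun i r => Q i * c i ^ r)
    (fun i hi r hr j hj r' hr' heq => ?_) (fun i hi r _ => ?_) (fun i hi r hr => ?_) (by simpa)
  · have hmem : (Q i)⁻¹ * Q j ∈ K := by
      rw [eq_mul_inv_of_mul_eq heq.symm, mul_assoc, inv_mul_cancel_left]
      exact mul_mem (hpow hi r) (inv_mem (hpow hj r'))
    obtain rfl := hcosets i hi j hj hmem
    exact ⟨rfl, pow_injOn_Iio_orderOf (horder hi ▸ hr) (horder hi ▸ hr') (mul_left_cancel heq)⟩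
  · simpa [pow_succ, mul_assoc] using hcS i hi
  · have hlast : (c i)⁻¹ = c i ^ r := by
      rw [inv_eq_iff_mul_eq_one, ← pow_succ', hr, ← horder hi, pow_orderOf_eq_one]
    rw [pow_zero, mul_one, hQ i hi, hlast, inv_mul_cancel_left]
    exact htS i hi

end CayleyGraphs

section Words

variable {ι H H' : Type*} [Group H] [Group H']

/-- An element raised to a sign, `true` standing for `1` and `false` for `-1`. -/
def signedPower (b : H) (ε : Bool) : H := bif ε then b else b⁻¹

theorem signedPower_mem {S : Set H} {b : H} (hb : b ∈ S) (ε : Bool) :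
    signedPower b ε ∈ S ∪ S⁻¹ := by
  cases ε <;> simp [signedPower, hb]

theorem map_signedPower (φ : H →* H') (b : H) (ε : Bool) :
    φ (signedPower b ε) = signedPower (φ b) ε := by
  cases ε <;> simp [signedPower]

theorem zpowers_signedPower (b : H) (ε : Bool) :
    Subgroup.zpowers (signedPower b ε) = Subgroup.zpowers b := by
  cases ε <;> simp [signedPower]

/-- The value of a signed letter under an assignment of group elements to the unsigned letters. -/
def letterValue (g : ι → H) (x : ι × Bool) : H := signedPower (g x.1) x.2

/-- The value in a group of a word in signed letters. Words are not reduced, since their prefixes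
trace walks in a Cayley graph. -/
def wordValue (g : ι → H) (w : List (ι × Bool)) : H := (w.map (letterValue g)).prod

@[simp] theorem wordValue_nil (g : ι → H) : wordValue g [] = 1 := rfl

@[simp] theorem wordValue_cons (g : ι → H) (x : ι × Bool) (w : List (ι × Bool)) :
    wordValue g (x :: w) = letterValue g x * wordValue g w := List.prod_cons

@[simp] theorem wordValue_append (g : ι → H) (v w : List (ι × Bool)) :
    wordValue g (v ++ w) = wordValue g v * wordValue g w := by
  simp [wordValue]

theorem wordValue_take_succ (g : ι → H) (w : List (ι × Bool)) {i : ℕ} (hi : i < w.length) :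
    wordValue g (w.take (i + 1)) = wordValue g (w.take i) * letterValue g w[i] := by
  rw [List.take_succ_eq_append_getElem hi, wordValue_append, wordValue_cons, wordValue_nil, mul_one]

theorem map_wordValue (φ : H →* H') (g : ι → H) (w : List (ι × Bool)) :
    φ (wordValue g w) = wordValue (fun i => φ (g i)) w := by
  induction w with
  | nil => simp
  | cons x w ih => simp [letterValue, map_signedPower, ih]

theorem wordValue_prodMk (g : ι → H) (z : ι → H') (w : List (ι × Bool)) :
    wordValue (fun i => (g i, z i)) w = (wordValue g w, wordValue z w) :=
  Prod.ext (map_wordValue (.fst H H') _ w) (map_wordValue (.snd H H') _ w)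

/-- A word is Hamiltonian if its prefixes trace a Hamiltonian cycle of the group: they visit every
element once before the whole word returns to `1`. -/
structure IsHamiltonianWord (g : ι → H) (w : List (ι × Bool)) : Prop where
  length_eq : w.length = Nat.card H
  injOn : Set.InjOn (fun i => wordValue g (w.take i)) (Set.Iio w.length)
  wordValue_eq_one : wordValue g w = 1

namespace IsHamiltonianWord

variable {g : ι → H} {v w : List (ι × Bool)}

theorem of_map_letterValue_eq (hv : IsHamiltonianWord g v)
    (h : v.map (letterValue g) = w.map (letterValue g)) : IsHamiltonianWord g w := by
  have hlength : v.length = w.length := by simpa using congrArg List.length h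
  have hvalue : wordValue g v = wordValue g w := congrArg List.prod h
  have hprefix : ∀ i, wordValue g (v.take i) = wordValue g (w.take i) := fun i => by
    simp only [wordValue, List.map_take, h]
  exact ⟨hlength ▸ hv.length_eq, by simpa only [hlength, hprefix] using hv.injOn,
    hvalue ▸ hv.wordValue_eq_one⟩

theorem map_iff (φ : H ≃* H') :
    IsHamiltonianWord (fun i => φ (g i)) w ↔ IsHamiltonianWord g w := by
  have hmap (v : List (ι × Bool)) : wordValue (fun i => φ (g i)) v = φ (wordValue g v) :=
    (map_wordValue φ.toMonoidHom g v).symm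
  have hinj : (fun i => wordValue (fun i => φ (g i)) (w.take i)) =
      φ ∘ fun i => wordValue g (w.take i) := funext fun i => hmap _
  constructor
  · intro ⟨h₁, h₂, h₃⟩
    exact ⟨h₁.trans (Nat.card_congr φ.symm.toEquiv), (hinj ▸ h₂).of_comp,
      by simpa [hmap] using h₃⟩
  · intro ⟨h₁, h₂, h₃⟩
    exact ⟨h₁.trans (Nat.card_congr φ.toEquiv), hinj ▸ φ.injective.comp_injOn h₂,
      by simp [hmap, h₃]⟩

end IsHamiltonianWord

theorem inv_wordValue_take_mul {g : ι → H} {S : Set H} (hg : ∀ i, g i ∈ S) {w : List (ι × Bool)}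
    {i : ℕ} (hi : i < w.length) :
    (wordValue g (w.take i))⁻¹ * wordValue g (w.take (i + 1)) ∈ S ∪ S⁻¹ := by
  rw [wordValue_take_succ g w hi, inv_mul_cancel_left]
  exact signedPower_mem (hg _) _

end Words

section DirectProducts

variable {ι H Z : Type*} [Group H] [Group Z] [Fintype H] [Fintype Z] [DecidableEq H]
  [DecidableEq Z] {S : Set (H × Z)} {g : ι → H} {z : ι → Z} {w : List (ι × Bool)}

/- The walk traced by `w` lifts to a walk from `1` to `(1, ζ)`, where `ζ` is the value of `w` in
`Z`. Its translates by the powers of `(1, ζ)` join up. -/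
theorem mulCayley_prod_isHamiltonian_of_zpowers_eq_top (hthree : 3 ≤ Fintype.card (H × Z))
    (hS : ∀ i, (g i, z i) ∈ S) (hw : IsHamiltonianWord g w)
    (hz : Subgroup.zpowers (wordValue z w) = ⊤) : (SimpleGraph.mulCayley S).IsHamiltonian := by
  have hlength : w.length = Fintype.card H := hw.length_eq.trans Nat.card_eq_fintype_card
  have horder : orderOf (wordValue z w) = Fintype.card Z := by
    rw [← Nat.card_eq_fintype_card, ← Nat.card_zpowers, hz, Subgroup.card_top]
  have hcard : Fintype.card (H × Z) = Fintype.card Z * w.length := by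
    rw [Fintype.card_prod, mul_comm, hlength]
  let a (i : ι) : H × Z := (g i, z i)
  have hvalue : wordValue a w = (1, wordValue z w) := by
    rw [wordValue_prodMk, hw.wordValue_eq_one]
  refine mulCayley_isHamiltonian_of_rows (hcard ▸ hthree) hcard
    (fun q r => wordValue a w ^ q * wordValue a (w.take r))
    (fun q hq r hr q' hq' r' hr' heq => ?_) (fun q _ r hr => ?_) (fun q _ r hr => ?_) ?_
  · simp only [hvalue, a, wordValue_prodMk, Prod.ext_iff, Prod.fst_mul, Prod.snd_mul, Prod.pow_fst,
      Prod.pow_snd, one_pow, one_mul] at heq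
    obtain rfl := hw.injOn hr hr' heq.1
    exact ⟨pow_injOn_Iio_orderOf (horder ▸ hq) (horder ▸ hq') (mul_right_cancel heq.2), rfl⟩
  · have := inv_wordValue_take_mul hS (Nat.lt_of_succ_lt hr)
    simpa [mul_assoc] using this
  · have := inv_wordValue_take_mul hS (by lia : r < w.length)
    rw [hr, List.take_length] at this
    simpa [pow_succ, mul_assoc] using this
  · simp [hvalue, ← horder, pow_orderOf_eq_one]

/- The rows are the cosets of the central subgroup `1 × Z`, traversed alternately forwards and
backwards. They close up because the number of rows is even. -/
theorem mulCayley_prod_isHamiltonian_of_one_mem (hthree : 3 ≤ Fintype.card (H × Z))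
    (hS : ∀ i, (g i, z i) ∈ S) (hw : IsHamiltonianWord g w) (hwz : wordValue z w = 1)
    (heven : Even (Nat.card H)) {ζ : Z} (hζS : (1, ζ) ∈ S) (hζ : Subgroup.zpowers ζ = ⊤) :
    (SimpleGraph.mulCayley S).IsHamiltonian := by
  let a (i : ι) : H × Z := (g i, z i)
  let b : H × Z := (1, ζ)
  have hcomm (x : H × Z) : Commute x b := by
    obtain ⟨k, hk⟩ := Subgroup.mem_zpowers_iff.1 (hζ ▸ Subgroup.mem_top x.2)
    exact Prod.ext (by simp [b])
      (by simpa [b, ← hk] using ((Commute.refl ζ).zpow_left k).eq)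
  have hK : Nat.card (Subgroup.zpowers b) = Nat.card Z := by
    rw [Nat.card_zpowers, Prod.orderOf_mk, orderOf_one, Nat.lcm_one_left, ← Nat.card_zpowers, hζ,
      Subgroup.card_top]
  have hcard : Fintype.card (H × Z) = w.length * Nat.card (Subgroup.zpowers b) := by
    rw [hK, hw.length_eq, ← Nat.card_prod, Nat.card_eq_fintype_card]
  let P (i : ℕ) : H × Z := wordValue a (w.take i)
  let Q (i : ℕ) : H × Z := if Even i then P i else P i * b⁻¹
  have hQfst (i : ℕ) : (Q i).1 = wordValue g (w.take i) := by
    simp only [Q, P, a, b, wordValue_prodMk]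
    split_ifs <;> simp
  refine mulCayley_isHamiltonian_of_cosets hcard hthree (fun i => signedPower b (Even i))
    (fun i => (P i)⁻¹ * P (i + 1)) Q (fun i _ => signedPower_mem hζS _)
    (fun i _ => zpowers_signedPower b _) (fun i hi => inv_wordValue_take_mul hS hi)
    (fun i _ => ?_) (fun i hi j hj hij => ?_) ?_
  · by_cases hi : Even i
    · have hcomm' (x : H × Z) : x * b⁻¹ = b⁻¹ * x := (hcomm x).inv_right.eq
      simp [Q, signedPower, hi, Nat.even_add_one, hcomm', mul_assoc]
    · simp [Q, signedPower, hi, Nat.even_add_one]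
  · have hij' : ((Q i)⁻¹ * Q j).1 = 1 := by
      obtain ⟨k, hk⟩ := hij
      simp [← hk, b]
    rw [Prod.fst_mul, Prod.fst_inv, inv_mul_eq_one, hQfst, hQfst] at hij'
    exact hw.injOn hi hj hij'
  · have : Even w.length := hw.length_eq ▸ heven
    simp [Q, P, a, this, wordValue_prodMk, hw.wordValue_eq_one, hwz]

end DirectProducts

section BlockWords

variable {ι H H' : Type*} [Group H] [Group H'] {i j : ι} {n : ℕ} {signs : List Bool}

/-- The word made of one block `iⁿ j` for every sign `true` and one block `i⁻ⁿ j` for every sign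
`false`. If `i` has order `n + 1`, then each block runs through a coset of the subgroup generated
by `i` before it leaves that coset. -/
def blockWord (i j : ι) (n : ℕ) (signs : List Bool) : List (ι × Bool) :=
  signs.flatMap fun ε => List.replicate n (i, ε) ++ [(j, true)]

theorem blockWord_cons (ε : Bool) : blockWord i j n (ε :: signs) =
    List.replicate n (i, ε) ++ [(j, true)] ++ blockWord i j n signs :=
  List.flatMap_cons

theorem blockWord_append (signs' : List Bool) :
    blockWord i j n (signs ++ signs') = blockWord i j n signs ++ blockWord i j n signs' :=
  List.flatMap_append

theorem length_blockWord : (blockWord i j n signs).length = signs.length * (n + 1) := by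
  simp [blockWord]

theorem take_blockWord {k r : ℕ} (hk : k < signs.length) (hr : r ≤ n) :
    (blockWord i j n signs).take (k * (n + 1) + r) =
      blockWord i j n (signs.take k) ++ List.replicate r (i, signs[k]) := by
  have hlength : (blockWord i j n (signs.take k)).length = k * (n + 1) := by
    rw [length_blockWord, List.length_take_of_le hk.le]
  conv_lhs => rw [← List.take_append_drop k signs, blockWord_append, ← hlength,
    List.take_length_add_append, List.drop_eq_getElem_cons hk, blockWord_cons]
  simp [List.take_append_of_le_length, hr]

/-- The product of the elements `x⁻¹ y` for the signs `true` and `x y` for the signs `false`. It is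
the value of a block word when `x ^ (n + 1) = 1`. -/
def blockProduct (x y : H) (signs : List Bool) : H :=
  (signs.map fun ε => (signedPower x ε)⁻¹ * y).prod

theorem map_blockProduct (φ : H →* H') (x y : H) :
    φ (blockProduct x y signs) = blockProduct (φ x) (φ y) signs := by
  simp [blockProduct, map_list_prod, Function.comp_def, map_signedPower]

theorem blockProduct_one (x : H) :
    blockProduct x 1 signs = x ^ ((signs.count false : ℤ) - signs.count true) := by
  induction signs with
  | nil => simp [blockProduct]
  | cons ε signs ih =>
    have hε : (signedPower x ε)⁻¹ * 1 = x ^ (bif ε then -1 else 1 : ℤ) := by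
      cases ε <;> simp [signedPower]
    rw [blockProduct, List.map_cons, List.prod_cons, ← blockProduct, ih, hε, ← zpow_add]
    congr 1
    cases ε <;> simp <;> ring

variable {g : ι → H}

theorem wordValue_replicate (ε : Bool) (r : ℕ) :
    wordValue g (List.replicate r (i, ε)) = signedPower (g i) ε ^ r := by
  simp [wordValue, letterValue]

theorem wordValue_blockWord (hg : g i ^ (n + 1) = 1) :
    wordValue g (blockWord i j n signs) = blockProduct (g i) (g j) signs := by
  have hpow (ε : Bool) : signedPower (g i) ε ^ n = (signedPower (g i) ε)⁻¹ := by
    rw [eq_inv_iff_mul_eq_one, ← pow_succ]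
    cases ε <;> simp [signedPower, hg]
  induction signs with
  | nil => rfl
  | cons ε signs ih =>
    rw [blockWord_cons, wordValue_append, wordValue_append, wordValue_replicate, hpow, ih]
    simp [blockProduct, letterValue, signedPower]

theorem IsHamiltonianWord.mem_of_blockWord [Finite H]
    (hw : IsHamiltonianWord g (blockWord i j n signs)) : (j, true) ∈ blockWord i j n signs := by
  obtain ⟨ε, hε⟩ : ∃ ε, ε ∈ signs := List.exists_mem_of_ne_nil _ fun hnil =>
    Nat.card_pos.ne (by simpa [hnil, blockWord] using hw.length_eq)
  exact List.mem_flatMap.2 ⟨ε, hε, by simp⟩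

theorem eq_of_inv_mul_blockProduct_mem (hg : orderOf (g i) = n + 1)
    (hw : IsHamiltonianWord g (blockWord i j n signs)) {k l : ℕ} (hk : k < signs.length)
    (hl : l < signs.length) (hkl : (blockProduct (g i) (g j) (signs.take k))⁻¹ *
      blockProduct (g i) (g j) (signs.take l) ∈ Subgroup.zpowers (g i)) : k = l := by
  have hprefix {k r : ℕ} (hk : k < signs.length) (hr : r ≤ n) :
      wordValue g ((blockWord i j n signs).take (k * (n + 1) + r)) =
        blockProduct (g i) (g j) (signs.take k) * signedPower (g i) signs[k] ^ r := by
    rw [take_blockWord hk hr, wordValue_append, wordValue_replicate,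
      wordValue_blockWord (hg ▸ pow_orderOf_eq_one _)]
  have hlt {k r : ℕ} (hk : k < signs.length) (hr : r ≤ n) :
      k * (n + 1) + r < (blockWord i j n signs).length := by
    rw [length_blockWord]
    nlinarith
  have horder : orderOf (signedPower (g i) signs[k]) = n + 1 := by
    rw [← hg, ← Nat.card_zpowers, zpowers_signedPower, Nat.card_zpowers]
  obtain ⟨r, hr, hrl⟩ : ∃ r ≤ n, signedPower (g i) signs[k] ^ r =
      (blockProduct (g i) (g j) (signs.take k))⁻¹ * blockProduct (g i) (g j) (signs.take l) := by
    classical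
    have hfinite : IsOfFinOrder (signedPower (g i) signs[k]) :=
      orderOf_pos_iff.1 (horder ▸ n.succ_pos)
    rw [← zpowers_signedPower _ signs[k], hfinite.mem_zpowers_iff_mem_range_orderOf, horder] at hkl
    obtain ⟨r, hr, hrl⟩ := Finset.mem_image.1 hkl
    exact ⟨r, Nat.lt_succ_iff.1 (Finset.mem_range.1 hr), hrl⟩
  have heq := hw.injOn (hlt hk hr) (hlt hl n.zero_le) (by
    simp only [hprefix hk hr, hprefix hl n.zero_le, hrl, mul_inv_cancel_left, pow_zero, mul_one])
  rcases lt_trichotomy k l with h | h | h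
  · nlinarith
  · exact h
  · nlinarith

variable {Z : Type*} [Group Z] [Fintype H] [Fintype Z] [DecidableEq H] [DecidableEq Z]
  {S : Set (H × Z)} {g : ι → H}

theorem mulCayley_prod_isHamiltonian_of_blockWord (hthree : 3 ≤ Fintype.card (H × Z))
    (hg : orderOf (g i) = n + 1) (hcop : (n + 1).Coprime (Nat.card Z)) {ζ : Z}
    (hζ : Subgroup.zpowers ζ = ⊤) (hiS : (g i, ζ) ∈ S) (hjS : (g j, 1) ∈ S)
    (hw : IsHamiltonianWord g (blockWord i j n signs))
    (hsigns : signs.count true = signs.count false) :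
    (SimpleGraph.mulCayley S).IsHamiltonian := by
  let b : H × Z := (g i, ζ)
  let t : H × Z := (g j, 1)
  have hK : Nat.card (Subgroup.zpowers b) = (n + 1) * Nat.card Z := by
    rw [Nat.card_zpowers, Prod.orderOf_mk, hg, ← Nat.card_zpowers ζ, hζ, Subgroup.card_top,
      hcop.lcm_eq_mul]
  have hcard : Fintype.card (H × Z) = signs.length * Nat.card (Subgroup.zpowers b) := by
    rw [hK, ← mul_assoc, ← length_blockWord, hw.length_eq, ← Nat.card_prod,
      Nat.card_eq_fintype_card]
  have hfst (k : ℕ) : (blockProduct b t (signs.take k)).1 =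
      blockProduct (g i) (g j) (signs.take k) := map_blockProduct (.fst H Z) b t
  refine mulCayley_isHamiltonian_of_cosets hcard hthree
    (fun k => signedPower b (signs.getD k true)) (fun _ => t)
    (fun k => blockProduct b t (signs.take k)) (fun _ _ => signedPower_mem hiS _)
    (fun _ _ => zpowers_signedPower b _) (fun _ _ => .inl hjS) (fun k hk => ?_)
    (fun k hk l hl hkl => eq_of_inv_mul_blockProduct_mem hg hw hk hl ?_) ?_
  · rw [List.take_succ_eq_append_getElem hk]
    simp [blockProduct, hk, mul_assoc]
  · obtain ⟨e, he⟩ := hkl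
    exact ⟨e, by simpa [hfst] using congrArg Prod.fst he⟩
  · have hH : blockProduct (g i) (g j) signs = 1 := by
      rw [← wordValue_blockWord (hg ▸ pow_orderOf_eq_one _), hw.wordValue_eq_one]
    have hZ : blockProduct ζ 1 signs = 1 := by simp [blockProduct_one, hsigns]
    simp only [List.take_length, List.take_zero]
    exact Prod.ext ((map_blockProduct (.fst H Z) b t).trans hH)
      ((map_blockProduct (.snd H Z) b t).trans hZ)

end BlockWords

section CycleLattice

variable {ι H H' : Type*} [DecidableEq ι] [Group H] [Group H'] {g : ι → H}

/-- The exponent sum of every letter in a word, that is, the image of the word in the free abelian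
group on the letters. -/
def exponentSums (w : List (ι × Bool)) : ι → ℤ :=
  (w.map fun x => Pi.single x.1 (bif x.2 then 1 else -1)).sum

@[simp] theorem exponentSums_cons (x : ι × Bool) (w : List (ι × Bool)) :
    exponentSums (x :: w) = Pi.single x.1 (bif x.2 then 1 else -1) + exponentSums w :=
  List.sum_cons

theorem exponentSums_append (v w : List (ι × Bool)) :
    exponentSums (v ++ w) = exponentSums v + exponentSums w := by
  simp [exponentSums]

/-- The subgroup of `ℤ^ι` generated by the exponent sums of the Hamiltonian words. -/
def cycleLattice (g : ι → H) : AddSubgroup (ι → ℤ) :=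
  .closure (exponentSums '' {w | IsHamiltonianWord g w})

theorem IsHamiltonianWord.exponentSums_mem {w : List (ι × Bool)} (hw : IsHamiltonianWord g w) :
    exponentSums w ∈ cycleLattice g :=
  AddSubgroup.subset_closure ⟨w, hw, rfl⟩

theorem cycleLattice_map (φ : H ≃* H') : cycleLattice (fun i => φ (g i)) = cycleLattice g := by
  simp only [cycleLattice, IsHamiltonianWord.map_iff]

theorem exists_isHamiltonianWord_of_mem_cycleLattice {v : ι → ℤ} (hv : v ∈ cycleLattice g)
    (hv₀ : v ≠ 0) : ∃ w, IsHamiltonianWord g w := by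
  contrapose! hv₀
  have hempty : {w | IsHamiltonianWord g w} = ∅ := Set.eq_empty_of_forall_notMem hv₀
  simpa [cycleLattice, hempty] using hv

/- An involution may be replaced by its inverse, which changes its exponent sum by `2`. -/
theorem single_two_mem_cycleLattice {i : ι} {w : List (ι × Bool)} (hi : (g i)⁻¹ = g i)
    (hw : IsHamiltonianWord g w) (hiw : (i, true) ∈ w) :
    Pi.single i 2 ∈ cycleLattice g := by
  obtain ⟨u, v, rfl⟩ := List.append_of_mem hiw
  have hflip : IsHamiltonianWord g (u ++ (i, false) :: v) :=
    hw.of_map_letterValue_eq (by simp [letterValue, signedPower, hi])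
  have hdiff : Pi.single i 2 =
      exponentSums (u ++ (i, true) :: v) - exponentSums (u ++ (i, false) :: v) := by
    simp [exponentSums_append, Pi.single_neg, ← Pi.single_add]
  exact hdiff ▸ sub_mem hw.exponentSums_mem hflip.exponentSums_mem

variable {Z : Type*} [CommGroup Z]

theorem prod_zpow_single [Fintype ι] (z : ι → Z) (i : ι) (e : ℤ) :
    ∏ j, z j ^ (Pi.single i e : ι → ℤ) j = z i ^ e := by
  simp [Pi.single_apply]

theorem wordValue_eq_prod_zpow [Fintype ι] (z : ι → Z) (w : List (ι × Bool)) :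
    wordValue z w = ∏ i, z i ^ exponentSums w i := by
  induction w with
  | nil => simp [exponentSums]
  | cons x w ih =>
    obtain ⟨i, _ | _⟩ := x <;>
      simp only [wordValue_cons, exponentSums_cons, Pi.add_apply, zpow_add, Finset.prod_mul_distrib,
        prod_zpow_single, ih, letterValue, signedPower, cond_true, cond_false, zpow_one, zpow_neg]

theorem exists_wordValue_ne_one [Fintype ι] {v : ι → ℤ} (hv : v ∈ cycleLattice g)
    {z : ι → Z} (hz : ∏ i, z i ^ v i ≠ 1) : ∃ w, IsHamiltonianWord g w ∧ wordValue z w ≠ 1 := by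
  contrapose! hz
  induction hv using AddSubgroup.closure_induction with
  | mem v hv =>
    obtain ⟨w, hw, rfl⟩ := hv
    rw [← wordValue_eq_prod_zpow, hz w hw]
  | zero => simp
  | add u v _ _ hu hv => simp [zpow_add, Finset.prod_mul_distrib, hu, hv]
  | neg v _ hv => simp [hv]

theorem exists_wordValue_ne_one_of_single_mem [Finite ι] {i : ι} {e : ℤ}
    (hv : Pi.single i e ∈ cycleLattice g) {z : ι → Z} (hz : z i ^ e ≠ 1) :
    ∃ w, IsHamiltonianWord g w ∧ wordValue z w ≠ 1 := by
  cases nonempty_fintype ι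
  exact exists_wordValue_ne_one hv (by rwa [prod_zpow_single])

end CycleLattice

section Certificates

open Equiv

/-- The images of `0, …, 4` as the octal digits, lowest first, of a number. The kernel looks up a
digit much faster than it evaluates a permutation. -/
def permCode (σ : Perm (Fin 5)) : ℕ := σ 0 + 8 * (σ 1 + 8 * (σ 2 + 8 * (σ 3 + 8 * σ 4)))

theorem permCode_div_mod (σ : Perm (Fin 5)) (i : Fin 5) : permCode σ / 8 ^ (i : ℕ) % 8 = σ i := by
  have hlt (j : Fin 5) : (σ j : ℕ) < 5 := (σ j).isLt
  have := hlt 0; have := hlt 1; have := hlt 2; have := hlt 3; have := hlt 4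
  unfold permCode
  match i with
  | 0 | 1 | 2 | 3 | 4 =>
    norm_num
    omega

/-- Function application that forces the evaluation of the argument. Without it the kernel would
substitute unevaluated arguments and evaluate them again at every occurrence. -/
def forceNat {α : Type*} (n : ℕ) (f : ℕ → α) : α := Nat.casesOn n (f 0) fun k => f (k + 1)

@[simp] theorem forceNat_eq {α : Type*} (n : ℕ) (f : ℕ → α) : forceNat n f = f n := by
  cases n <;> rfl

/-- The preimages of `0`, `1` and `2` under a permutation as the digits, lowest first, of a number
in base `5`. -/
def preimageCode (i j k : ℕ) : ℕ := i + 5 * (j + 5 * k)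

/-- Whether a walk avoids the recorded vertices and itself until it ends in `1`. Its steps multiply
an even permutation `σ` on the right by the values of letters, and `t` yields the codes of their
inverses. Such a `σ` is represented by the preimages `i`, `j` and `k` of `0`, `1` and `2`, and the
bit set `visited` contains the numbers `preimageCode i j k` of the recorded vertices. -/
def isHamiltonianWalk (t : ℕ → ℕ) : List ℕ → ℕ → ℕ → ℕ → ℕ → Bool
  | [], i, j, k, _ => i == 0 && j == 1 && k == 2
  | d :: l, i, j, k, visited =>
    forceNat (preimageCode i j k) fun x => !visited.testBit x && forceNat (t d) fun y =>
    forceNat (y / 8 ^ i % 8) fun i' => forceNat (y / 8 ^ j % 8) fun j' =>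
    forceNat (y / 8 ^ k % 8) fun k' => isHamiltonianWalk t l i' j' k' (visited ||| 1 <<< x)

/-- Selection by a digit. The digits `2i` and `2i + 1` stand for the `i`-th of three generators and
its inverse. -/
def selectLetter {α : Type*} (a a' b b' c c' : α) : ℕ → α
  | 0 => a
  | 1 => a'
  | 2 => b
  | 3 => b'
  | 4 => c
  | _ => c'

theorem apply_selectLetter {α β : Type*} (f : α → β) (a a' b b' c c' : α) (d : ℕ) :
    f (selectLetter a a' b b' c c' d) =
      selectLetter (f a) (f a') (f b) (f b') (f c) (f c') d := by
  unfold selectLetter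
  split <;> rfl

/-- The signed letter that a digit stands for. -/
def letterOfDigit : ℕ → Fin 3 × Bool :=
  selectLetter (0, true) (0, false) (1, true) (1, false) (2, true) (2, false)

/-- The sixty lowest octal digits of a number, lowest first. -/
def octalDigits (n : ℕ) : List ℕ := (List.range 60).map fun i => n / 8 ^ i % 8

/-- The word of length sixty that is encoded by the octal digits of a number. -/
def octalWord (n : ℕ) : List (Fin 3 × Bool) := (octalDigits n).map letterOfDigit

/-- Apply a test to the codes of the inverses of three permutations and of their inverses, which
are evaluated only once. -/
def withLetterCodes {α : Type*} (σ τ υ : Perm (Fin 5)) (f : (ℕ → ℕ) → α) : α :=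
  forceNat (permCode σ⁻¹) fun a => forceNat (permCode σ) fun a' =>
  forceNat (permCode τ⁻¹) fun b => forceNat (permCode τ) fun b' =>
  forceNat (permCode υ⁻¹) fun c => forceNat (permCode υ) fun c' =>
    f (selectLetter a a' b b' c c')

/-- The code of the inverse of the value of the letter that a digit stands for. -/
def letterCode (g : Fin 3 → alternatingGroup (Fin 5)) (d : ℕ) : ℕ :=
  permCode (letterValue g (letterOfDigit d) : alternatingGroup (Fin 5))⁻¹

theorem withLetterCodes_eq {α : Type*} (σ τ υ : alternatingGroup (Fin 5)) (f : (ℕ → ℕ) → α) :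
    withLetterCodes σ τ υ f = f (letterCode ![σ, τ, υ]) := by
  have h := apply_selectLetter
    (fun x => permCode (letterValue ![σ, τ, υ] x : alternatingGroup (Fin 5))⁻¹)
    (0, true) (0, false) (1, true) (1, false) (2, true) (2, false)
  simp only [withLetterCodes, forceNat_eq]
  refine congrArg f (funext fun d => ?_)
  rw [letterCode, letterOfDigit, h]
  simp [letterValue, signedPower]

theorem card_alternatingGroup_five : Nat.card (alternatingGroup (Fin 5)) = 60 := by
  rw [nat_card_alternatingGroup, Nat.card_fin]
  rfl

variable {σ τ υ : alternatingGroup (Fin 5)}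

theorem eq_one_of_inv_apply_eq (h₀ : (σ : Perm (Fin 5))⁻¹ 0 = 0)
    (h₁ : (σ : Perm (Fin 5))⁻¹ 1 = 1) (h₂ : (σ : Perm (Fin 5))⁻¹ 2 = 2) : σ = 1 := by
  revert σ
  decide +kernel

/-- The number under which the checker records an even permutation. -/
def vertexCode (σ : alternatingGroup (Fin 5)) : ℕ :=
  preimageCode ((σ : Perm (Fin 5))⁻¹ 0) ((σ : Perm (Fin 5))⁻¹ 1) ((σ : Perm (Fin 5))⁻¹ 2)

theorem isHamiltonianWalk_sound (g : Fin 3 → alternatingGroup (Fin 5)) (l : List ℕ)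
    (σ : alternatingGroup (Fin 5)) (visited : ℕ)
    (h : isHamiltonianWalk (letterCode g) l ((σ : Perm (Fin 5))⁻¹ 0) ((σ : Perm (Fin 5))⁻¹ 1)
      ((σ : Perm (Fin 5))⁻¹ 2) visited = true) :
    (∀ i < l.length,
        visited.testBit (vertexCode (σ * wordValue g ((l.map letterOfDigit).take i))) = false) ∧
      Set.InjOn (fun i => wordValue g ((l.map letterOfDigit).take i)) (Set.Iio l.length) ∧
      σ * wordValue g (l.map letterOfDigit) = 1 := by
  induction l generalizing σ visited with
  | nil =>
    simp only [isHamiltonianWalk, Bool.and_eq_true, beq_iff_eq] at h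
    simpa using eq_one_of_inv_apply_eq (Fin.ext h.1.1) (Fin.ext h.1.2) (Fin.ext h.2)
  | cons d l ih =>
    set a := letterValue g (letterOfDigit d) with ha
    have hstep (m : Fin 5) : letterCode g d / 8 ^ ((σ : Perm (Fin 5))⁻¹ m : ℕ) % 8 =
        ((σ * a : alternatingGroup (Fin 5)) : Perm (Fin 5))⁻¹ m := by
      simp [letterCode, permCode_div_mod, ha]
    simp only [isHamiltonianWalk, Bool.and_eq_true, forceNat_eq, hstep] at h
    obtain ⟨hσ, h⟩ := h
    obtain ⟨hfresh, hinj, hone⟩ := ih (σ * a) _ h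
    simp only [Nat.testBit_or, Bool.or_eq_false_iff, Nat.one_shiftLeft, Nat.testBit_two_pow,
      decide_eq_false_iff_not, mul_assoc] at hfresh
    have hne (i) (hi : i < l.length) : a * wordValue g ((l.map letterOfDigit).take i) ≠ 1 :=
      fun h => (hfresh i hi).2 (by rw [h, mul_one, vertexCode])
    refine ⟨?_, ?_, by simpa [mul_assoc] using hone⟩
    · rintro (_ | i) hi
      · simpa [vertexCode] using hσ
      · simpa using (hfresh i (by simpa using hi)).1
    · rintro (_ | i) hi (_ | j) hj hij
      · rfl
      · exact absurd (by simpa using hij.symm) (hne j (by simpa using hj))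
      · exact absurd (by simpa using hij) (hne i (by simpa using hi))
      · exact congrArg _ (hinj (by simpa using hi) (by simpa using hj) (by simpa using hij))

/-- Whether a word that is encoded by octal digits is Hamiltonian, where `t` yields the codes of the
inverses of the values of its letters. -/
def isHamiltonianCode (t : ℕ → ℕ) (n : ℕ) : Bool := isHamiltonianWalk t (octalDigits n) 0 1 2 0

theorem isHamiltonianWord_octalWord {g : Fin 3 → alternatingGroup (Fin 5)} {n : ℕ}
    (h : isHamiltonianCode (letterCode g) n = true) : IsHamiltonianWord g (octalWord n) := by
  obtain ⟨-, hinj, hone⟩ := isHamiltonianWalk_sound g (octalDigits n) 1 0 h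
  refine ⟨?_, by simpa [octalWord] using hinj, by simpa [octalWord] using hone⟩
  rw [card_alternatingGroup_five, octalWord, octalDigits, List.length_map, List.length_map,
    List.length_range]

/-- Whether one of the encoded words is Hamiltonian. -/
def anyHamiltonian (σ τ υ : alternatingGroup (Fin 5)) (words : List ℕ) : Bool :=
  withLetterCodes σ τ υ fun t => words.any (isHamiltonianCode t)

theorem exists_isHamiltonianWord_of_anyHamiltonian {words : List ℕ}
    (h : anyHamiltonian σ τ υ words = true) :
    ∃ n ∈ words, IsHamiltonianWord ![σ, τ, υ] (octalWord n) := by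
  rw [anyHamiltonian, withLetterCodes_eq, List.any_eq_true] at h
  obtain ⟨n, hn, hword⟩ := h
  exact ⟨n, hn, isHamiltonianWord_octalWord hword⟩

/-- Whether both words of one of the encoded pairs are Hamiltonian, whatever their coefficients. -/
def anyHamiltonianPair (σ τ υ : alternatingGroup (Fin 5)) (pairs : List ((ℤ × ℕ) × (ℤ × ℕ))) :
    Bool :=
  withLetterCodes σ τ υ fun t =>
    pairs.any fun q => isHamiltonianCode t q.1.2 && isHamiltonianCode t q.2.2

theorem exists_isHamiltonianWord_of_anyHamiltonianPair {pairs : List ((ℤ × ℕ) × (ℤ × ℕ))}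
    (h : anyHamiltonianPair σ τ υ pairs = true) :
    ∃ q ∈ pairs, IsHamiltonianWord ![σ, τ, υ] (octalWord q.1.2) ∧
      IsHamiltonianWord ![σ, τ, υ] (octalWord q.2.2) := by
  rw [anyHamiltonianPair, withLetterCodes_eq, List.any_eq_true] at h
  obtain ⟨q, hq, hwords⟩ := h
  rw [Bool.and_eq_true] at hwords
  exact ⟨q, hq, isHamiltonianWord_octalWord hwords.1, isHamiltonianWord_octalWord hwords.2⟩

/-- The number of points that the value of a word moves. -/
def movedCount (t : ℕ → ℕ) (digits : List ℕ) : ℕ :=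
  (List.range 5).countP fun i => digits.foldl (fun j d => t d / 8 ^ j % 8) i != i

/-- The numbers of points moved by `τ`, `υ`, `τ * υ`, `σ * τ` and `σ * υ`, as decimal digits, where
`t` yields the letter codes of `σ`, `τ` and `υ`. This invariant singles out the few words that are
worth trying for a triple of generators. -/
def tripleType (t : ℕ → ℕ) : ℕ :=
  [[2], [4], [2, 4], [0, 2], [0, 4]].foldl (fun n digits => 10 * n + movedCount t digits) 0

/-- Whether one of the encoded words is Hamiltonian, among those that are listed for the type of the
triple of generators. -/
def anyHamiltonianOfType (σ τ υ : alternatingGroup (Fin 5)) (words : List (ℕ × ℕ)) : Bool :=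
  withLetterCodes σ τ υ fun t => forceNat (tripleType t) fun k =>
    words.any fun q => q.1 == k && isHamiltonianCode t q.2

theorem exists_isHamiltonianWord_of_anyHamiltonianOfType {words : List (ℕ × ℕ)}
    (h : anyHamiltonianOfType σ τ υ words = true) :
    ∃ n ∈ words.map Prod.snd, IsHamiltonianWord ![σ, τ, υ] (octalWord n) := by
  rw [anyHamiltonianOfType, withLetterCodes_eq, forceNat_eq, List.any_eq_true] at h
  obtain ⟨q, hq, hword⟩ := h
  rw [Bool.and_eq_true] at hword
  exact ⟨q.2, List.mem_map_of_mem hq, isHamiltonianWord_octalWord hword.2⟩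

end Certificates

section Tables

/-- Words in the letters `0` and `1` whose exponent sums are `2` and `0`. -/
def netWords : List ℕ := [
  0o312203033033022111122111312212203300221330002212003313020330,
  0o213302022022033111133111213313302200331220003313002212030220,
  0o113030333130002211202211302002002002213112133330030022131121,
  0o122111121200331122021333033111212213000033130000300200300212,
  0o203021222202222120003021330333312213031333311312202021333302,
  0o000333133331302131312202211221300002213300202002113130021212,
  0o311330022112202113300202211330021330022003311311311203002020,
  0o031202033022002220031222203333022133331202122122113333113303,
  0o330022113033020333112221222003003113112002112221220330033130]

/-- Pairs of words in the letters `0` and `1`, with coefficients for which the exponent sums add up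
to `1102` and `0`. -/
def netPairs : List ((ℤ × ℕ) × (ℤ × ℕ)) := [
  ((19, 0o200003120302113000021130020030020300002130020000302000030200),
    (19, 0o300002130203112000031120030020030200003120030000203000020300)),
  ((29, 0o020000302130211113112000030020000302130000211300002113000020),
    (29, 0o030000203120311112113000020030000203120000311200003112000030)),
  ((171, 0o212203312002202002211330331330030212203312002202003303133112),
    (-19, 0o133112200002200030020220000202122122003303111213112111122003)),
  ((171, 0o111300002031300212111122033130022133002031133130002002000021),
    (-19, 0o120211312113002003300003303122003313303311312000220033031113)),
  ((133, 0o030203020022211300200311200333113330330333121122220030021120),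
    (38, 0o331131211222002020300311200330312112112112211300300220200220)),
  ((133, 0o020302030033311200300211300222112220220222131133330020031130),
    (38, 0o221121311333003030200211300220213113113113311200200330300330))]

/-- Words in the letters `0`, `1` and `2` whose exponent sums are `2`, `0` and `0`, each with the
value of `tripleType` for which it is tried. -/
def netTriples : List (ℕ × ℕ) := [
  (33334, 0o022055031552124241415120300330042214331513504420311552403430),
  (33343, 0o404112113052022551422040343305330030525305133405524434212112),
  (33433, 0o411340202404021335530434135140035240042115241511550020031552),
  (33444, 0o422420255303352500550213431552441522403313415340025113424430),
  (33533, 0o133505311224131150203424422500240240253515340024004031315531),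
  (33533, 0o525034140551330553535024143120441430211224402421430055053425),
  (33534, 0o040240343440055034422141120035240035505221531134152115203315),
  (33534, 0o251342253433522533044335515253315334243552244024402202503442),
  (33543, 0o503434434425033411420552141520244120305353425240053535502121),
  (33543, 0o514402114352044225152125503003550335244304220331511424403350),
  (33544, 0o420052531331550315130042434002044153140215243352522052114340),
  (33544, 0o531244352522433114243113525335521504003020441300512052443020),
  (34334, 0o120030200335020435342005121312211334002135120031120422151334),
  (34344, 0o133050042152140030500421250412530341221534300511341312500214),
  (34433, 0o352212411300353124005113302002402521402005130041225143131303),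
  (34443, 0o115330303140302005241122511330020031405221220212214203313033),
  (34533, 0o003531430331511204002211524133130052120422113300524302053422),
  (34533, 0o300524353002004353403112135022431150221411250421531420025343),
  (34534, 0o311352003302430502112200240302051425112415300242534051433113),
  (34534, 0o531311400331350241353122400250020242512134030251130214220330),
  (34543, 0o053004125113405300243033115004251312112433021220051300214120),
  (34543, 0o252214122120052411500330030430220215043511403035314351411300),
  (34544, 0o311500300204031153042003115213303340020025211422053311212241),
  (34544, 0o350331412253412152140220300225033034251433522140025334205143),
  (43433, 0o153500243004240340525531120413120342530243520315213152031244),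
  (43434, 0o350044021134125040034253114141205155035243044020515315524405),
  (43533, 0o342411311250403420302130551552531140205534211305024130204400),
  (43533, 0o403142414400435211551503004400213420055153524342531550051241),
  (43534, 0o135005203441250312434400253502035155002135112134024435213442),
  (43534, 0o150400440030241413414255003525535141200505534415514424113025),
  (44333, 0o030020300511203004211500300411205114300511425114130211351420),
  (44334, 0o300511203114203021350425003420053425003421151130211431150024),
  (44533, 0o035041524115311213400205004153112430211350420031150420503420),
  (44533, 0o153120405302134112531240053140200534200530214352413005124312),
  (44534, 0o350021130400524150435042504153112004003524302511413504251141),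
  (44534, 0o350203420030025143115243002503002415311420302130253112113124)]

/-- Words in the letters `0` and `1`, tried if the letter `0` stands for an involution. Its sign may
then be flipped. -/
def flipWords : List ℕ := [
  0o220330220330220330330330220220220330220330220330330330220220,
  0o333303033033330203030220330333303303333020303022033033033330,
  0o202222022022220330333302030333302222022033330333303302222030]

/-- Words in the letters `0`, `1` and `2`, each with the value of `tripleType` for which it is
tried. -/
def flipTriples : List (ℕ × ℕ) := [
  (33343, 0o505530205355335055030205522522055335055340534330553424422550),
  (33443, 0o422530344220225224335330225030240204334050433033534334403020),
  (33543, 0o522433534244225535525533022422550302044224052035034255302250),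
  (33543, 0o552552204043443522442442025203355253022422405225335225530330),
  (33544, 0o225533425524404425522040502250550304334334042250420224044330),
  (34343, 0o424334303422403020403020403340422422403043303342203342203340),
  (34345, 0o422422022422022420220433022433420220422033420220433022430330),
  (34345, 0o433403020422433422033430343302242243342202240304224224043340),
  (34544, 0o224030204034224220224224204033034020304303304030204020304330),
  (34545, 0o334330334330334330224224020304334033034030204030204030204330),
  (34545, 0o433433433033402030434033034330334303304220334220224224334220),
  (35344, 0o224424334302252252242052242204334022024224335522503025055220),
  (35444, 0o225342404243433033502202433505224033035020304030205030205330),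
  (35544, 0o224442404224044242522022522522550533034033034020305240240440),
  (35544, 0o334334442022040302043033553022555220224020305033050204224330),
  (43333, 0o252025055055025525044202552552525505525044204424404240440440),
  (43334, 0o552552042550442055052440552502404402550442442505502440552550),
  (43353, 0o524420525505525525504044020550244244205044025504404420550550),
  (43353, 0o552055044052055040525520424405250440552440255025520552550440),
  (43354, 0o420425524425520420244255205040255205040255244255044205020440),
  (43354, 0o442442440552404402440552440442442550204404204024250550202440),
  (43433, 0o242520442550202552502552502420442440552440552440525520442440),
  (43453, 0o244240204424402552504405525504240255250442550550442550552440),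
  (43453, 0o525520442440550420442550440550442550202042055202420440404240),
  (43533, 0o255255055205255055250520440204405504204402440524024255020440),
  (43533, 0o552402502025520244244055055250440520505255055244242442550440),
  (43553, 0o244240525255044240202552042440244205020552525044055042025520),
  (43553, 0o244255244255255044055250244255255044244244050244044255255250),
  (43553, 0o550255202425525504404424420424402550550420425504204424402550),
  (43553, 0o550442552550202550252440424052442424402405505524424405504420),
  (43554, 0o252442550552440442020244250550240440202524042505502440552040),
  (43554, 0o552550442550442552040502442050402050402550552550442050402550),
  (44335, 0o204240204204040204242404040420202424202024202420242042402040),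
  (44353, 0o204204024024040424240404202404204240240424240240242040242420),
  (44354, 0o424240420202024202024242024202024202420240424240424240424240),
  (44355, 0o204024020202040204020204020202404020204042040202020204042040),
  (44355, 0o420404040202040202042020404042040204202040404202040404204020),
  (44435, 0o404042402040204024204040202040424040242020242020242042402420),
  (44453, 0o202040204240204020404020204240204020204240404240204040204240),
  (44455, 0o404020242020242040402420202420402042404042404040404240404240),
  (44533, 0o424202024240202042024042042402042420402020402040204242024040),
  (44534, 0o402424042024204024202024204024042040242020242040242024042420),
  (44535, 0o420404024242040402404040424040204020404040402040204042404040),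
  (44535, 0o424024242424204040424040424240424204240404042424040404204240),
  (44553, 0o242402420420242024024020420204242042020420424020242042424020),
  (44553, 0o404202402020420240404204040202040240240404204204020204040240),
  (44554, 0o202404202424202404242020402020204020202040242024202404202420),
  (44555, 0o240420204040404020424042040240402020402042420402402404202020),
  (45334, 0o244044405020405025040250550402504024042044042020504055052040),
  (45334, 0o520255055550520555505205040550520242550555505204404240440550),
  (45354, 0o424240440250550202505204050204020555040240424050240420402440),
  (45354, 0o525504050442024404204055052050402555504444202040252052440550),
  (45534, 0o424404204050425052025020240444402440420405024444044442520440),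
  (45534, 0o525555205244250204205040242042404402505205040520502040504250),
  (45554, 0o442025052404250525040240420504024042505504050204050204404240),
  (45554, 0o520405552505520405020405250555505520405040502050255240440550),
  (53343, 0o255350204424025334250255342243552052530344334403303504424420),
  (53343, 0o553442552442552225524250550442550552424405505520502552443440),
  (53344, 0o424334420402030503442050205043440443302035530205343553020440),
  (53443, 0o224404424435022552522505030533335522224353055244255024042550),
  (53443, 0o344053403443333440255205224252202535205530342553440330344020),
  (53444, 0o553430553440243044225534205033533404403303553442442040502550),
  (53543, 0o204405343553044304424044335535535340442425525343443553034430),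
  (53543, 0o344255253525535534405034350553443355303504425224433535535530),
  (53543, 0o430344024422225242252224402442404344024404424404333443424420),
  (53543, 0o552443443442505255255224424303552440352443352244222240355350),
  (53544, 0o255224422550552405025055024044340433550552040305505355334430),
  (53544, 0o552552552204020440344342022442403040302505502044043552552550),
  (54343, 0o402042434042424022404340422402424204224224340433303430404030),
  (54343, 0o402402043402403024220422430343433042403043402040304240203040),
  (54344, 0o334340433330334240334030203040203042022030204303333040304020),
  (54345, 0o224243333033334020304020302030430342022220420222202242022220),
  (54345, 0o433422424224343424240204334243333434334202433434304042422040),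
  (54543, 0o243403040304020334333343340422043033402043342242043404042420),
  (54543, 0o334334204342033404020434204334333434243334030240404343430430),
  (54544, 0o424222420242222040203303402404302030420220330340304303302240),
  (54545, 0o222240203020304020302030430330203043303333034030203020433330),
  (54545, 0o433424303334243042240334042404030424033434024340220240434020),
  (55344, 0o334335242024253435505533303443505343043050240430504240503050),
  (55344, 0o442204020424203040204240425030405020405202403020503303402030),
  (55444, 0o420250205030205020340443033050425340503050334240205020302030),
  (55544, 0o533552404222202250440420402040503040205035055030205505353350)]

end Tables

section Generation

variable {H H' : Type*} [Group H] [Group H']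

theorem pow_ne_one_of_coprime {n : ℕ} (hn : (Nat.card H).Coprime n) {h : H} (hh : h ≠ 1) :
    h ^ n ≠ 1 := by
  simpa using hn.pow_left_bijective.injective.ne hh

theorem exists_mem_notMem_of_closure_eq_top {X : Set H} (hX : Subgroup.closure X = ⊤)
    {K : Subgroup H} (hK : K ≠ ⊤) : ∃ b ∈ X, b ∉ K := by
  contrapose! hK
  exact top_le_iff.1 (hX ▸ (Subgroup.closure_le K).2 hK)

theorem closure_image_fst_eq_top {X : Set (H × H')} (hX : Subgroup.closure X = ⊤) :
    Subgroup.closure (Prod.fst '' X) = ⊤ := by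
  rw [← MonoidHom.coe_fst, ← MonoidHom.map_closure, hX,
    Subgroup.map_top_of_surjective _ Prod.fst_surjective]

theorem exists_mem_snd_ne_one [Nontrivial H'] {X : Set (H × H')} (hX : Subgroup.closure X = ⊤) :
    ∃ x ∈ X, x.2 ≠ 1 := by
  obtain ⟨z, hz⟩ := exists_ne (1 : H')
  refine exists_mem_notMem_of_closure_eq_top hX (K := (MonoidHom.snd H H').ker) fun htop => hz ?_
  exact (MonoidHom.mem_ker (x := ((1 : H), z))).1 (htop ▸ Subgroup.mem_top _)

theorem exists_mem_smul_ne_of_closure_eq_top {α : Type*} [MulAction H α] {X : Set H}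
    (hX : Subgroup.closure X = ⊤) {h : H} {x : α} (hx : h • x ≠ x) : ∃ b ∈ X, b • x ≠ x :=
  exists_mem_notMem_of_closure_eq_top hX (K := MulAction.stabilizer H x) fun htop =>
    hx (MulAction.mem_stabilizer_iff.1 (htop ▸ Subgroup.mem_top h))

/-- Conjugation by `b` fixes or inverts `r`. -/
def ConjFixesOrInverts (r b : H) : Prop := b * r = r * b ∨ b * r = r⁻¹ * b

instance [DecidableEq H] : DecidableRel (ConjFixesOrInverts (H := H)) :=
  fun _ _ => inferInstanceAs (Decidable (_ ∨ _))

theorem ConjFixesOrInverts.mem_normalizer {r b : H} (h : ConjFixesOrInverts r b) :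
    b ∈ Subgroup.normalizer (Subgroup.zpowers r : Set H) := by
  rw [Subgroup.mem_normalizer_iff_map_conj_eq, MonoidHom.map_zpowers]
  rcases h with h | h <;> simp [h]

theorem exists_mem_not_conjFixesOrInverts [IsSimpleGroup H] {X : Set H}
    (hX : Subgroup.closure X = ⊤) {r c : H} (hrc : r * c ≠ c * r) :
    ∃ b ∈ X, ¬ConjFixesOrInverts r b := by
  have hnormalizer : Subgroup.normalizer (Subgroup.zpowers r : Set H) ≠ ⊤ := fun htop => by
    rcases (Subgroup.normalizer_eq_top_iff.1 htop).eq_bot_or_eq_top with h | h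
    · simp [Subgroup.zpowers_eq_bot.1 h] at hrc
    · obtain ⟨e, rfl⟩ := (h ▸ Subgroup.mem_top c : c ∈ Subgroup.zpowers r)
      exact hrc (Commute.self_zpow r e)
  obtain ⟨b, hb, hbr⟩ := exists_mem_notMem_of_closure_eq_top hX hnormalizer
  exact ⟨b, hb, fun h => hbr h.mem_normalizer⟩

end Generation

section Detection

variable {H H' : Type*} [Group H] [Group H']

/-- The letter `0` has order `3`, the letter `1` is an involution, and some balanced block word in
them is Hamiltonian. -/
def HasBlockWord (g : Fin 3 → H) : Prop :=
  orderOf (g 0) = 3 ∧ (g 1)⁻¹ = g 1 ∧ ∃ signs : List Bool,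
    signs.count true = signs.count false ∧ IsHamiltonianWord g (blockWord 0 1 2 signs)

/-- The Hamiltonian words in a triple of generators suffice to deal with any central component of
its first entry whose order does not divide `3 * 1102`. The number `1102 = 2 * 19 * 29` is a common
multiple of what the available words yield. -/
def IsDetecting (g : Fin 3 → H) : Prop := Pi.single 0 1102 ∈ cycleLattice g ∨ HasBlockWord g

theorem IsDetecting.of_single_two_mem {g : Fin 3 → H} (h : Pi.single 0 2 ∈ cycleLattice g) :
    IsDetecting g :=
  .inl <| by simpa [← Pi.single_smul] using zsmul_mem h 551

theorem IsDetecting.exists_isHamiltonianWord {g : Fin 3 → H} (hg : IsDetecting g) :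
    ∃ w, IsHamiltonianWord g w := by
  rcases hg with hlattice | ⟨-, -, signs, -, hw⟩
  · exact exists_isHamiltonianWord_of_mem_cycleLattice hlattice (by simp)
  · exact ⟨_, hw⟩

theorem isDetecting_map_iff (φ : H ≃* H') {g : Fin 3 → H} :
    IsDetecting (fun i => φ (g i)) ↔ IsDetecting g := by
  simp only [IsDetecting, HasBlockWord, cycleLattice_map, IsHamiltonianWord.map_iff,
    MulEquiv.orderOf_eq, ← map_inv, φ.injective.eq_iff]

/-- Every generating set contains two elements that form a detecting triple together with `s`. -/
def IsDetectable (s : H) : Prop :=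
  ∀ X : Set H, Subgroup.closure X = ⊤ → ∃ a ∈ X, ∃ b ∈ X, IsDetecting ![s, a, b]

theorem isDetectable_of_map (φ : H ≃* H') {s : H} (hs : IsDetectable (φ s)) : IsDetectable s := by
  intro X hX
  have hφX : Subgroup.closure (φ '' X) = ⊤ := by
    rw [← φ.coe_toMonoidHom, ← MonoidHom.map_closure, hX,
      Subgroup.map_top_of_surjective _ φ.surjective]
  obtain ⟨-, ⟨a, ha, rfl⟩, -, ⟨b, hb, rfl⟩, hab⟩ := hs _ hφX
  refine ⟨a, ha, b, hb, (isDetecting_map_iff φ).1 ?_⟩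
  convert hab using 1
  exact (FinVec.map_eq φ ![s, a, b]).symm

theorem exists_isDetecting_of_isDetectable (hX : Subgroup.closure X = ⊤) {t : H × H'} (ht : t ∈ X)
    (hdet : IsDetectable t.1) : ∃ (g : Fin 3 → H) (z : Fin 3 → H'),
      IsDetecting g ∧ z 0 = t.2 ∧ ∀ i, (g i, z i) ∈ X := by
  obtain ⟨-, ⟨a, ha, rfl⟩, -, ⟨b, hb, rfl⟩, hg⟩ := hdet _ (closure_image_fst_eq_top hX)
  refine ⟨![t.1, a.1, b.1], ![t.2, a.2, b.2], hg, rfl, fun i => ?_⟩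
  fin_cases i
  exacts [ht, ha, hb]

end Detection

section AlternatingGroupFive

open Equiv

variable {a b c : alternatingGroup (Fin 5)} {n : ℕ}

theorem exponentSums_octalWord_netWords :
    ∀ n ∈ netWords ++ netTriples.map Prod.snd, exponentSums (octalWord n) = Pi.single 0 2 := by
  decide +kernel

theorem exponentSums_octalWord_netPairs :
    ∀ q ∈ netPairs, q.1.1 • exponentSums (octalWord q.1.2) +
      q.2.1 • exponentSums (octalWord q.2.2) = Pi.single 0 1102 := by
  decide +kernel

theorem mem_octalWord_flipWords :
    ∀ n ∈ flipWords ++ flipTriples.map Prod.snd, (0, true) ∈ octalWord n := by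
  decide +kernel

theorem isDetecting_of_netWord (hn : n ∈ netWords ++ netTriples.map Prod.snd)
    (hw : IsHamiltonianWord ![a, b, c] (octalWord n)) : IsDetecting ![a, b, c] :=
  .of_single_two_mem <| exponentSums_octalWord_netWords n hn ▸ hw.exponentSums_mem

theorem isDetecting_of_netPair {q : (ℤ × ℕ) × (ℤ × ℕ)} (hq : q ∈ netPairs)
    (hw₁ : IsHamiltonianWord ![a, b, c] (octalWord q.1.2))
    (hw₂ : IsHamiltonianWord ![a, b, c] (octalWord q.2.2)) : IsDetecting ![a, b, c] :=
  .inl <| exponentSums_octalWord_netPairs q hq ▸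
    add_mem (zsmul_mem hw₁.exponentSums_mem _) (zsmul_mem hw₂.exponentSums_mem _)

theorem isDetecting_of_flipWord (ha : a⁻¹ = a) (hn : n ∈ flipWords ++ flipTriples.map Prod.snd)
    (hw : IsHamiltonianWord ![a, b, c] (octalWord n)) : IsDetecting ![a, b, c] :=
  .of_single_two_mem <| single_two_mem_cycleLattice ha hw (mem_octalWord_flipWords n hn)

/-- A balanced sequence of signs. Its block word is Hamiltonian for a `3`-cycle and some of the
involutions. -/
def blockSigns : List Bool :=
  [true, true, false, true, false, true, false, false, false, true,
    true, true, false, true, false, true, false, false, false, true]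

/-- The octal digits of the block word of `blockSigns`. -/
def blockCode : ℕ := 0o200211211211200211200211200200200211211211200211200211200200

theorem octalWord_blockCode : octalWord blockCode = blockWord 0 1 2 blockSigns := by decide +kernel

/-- The representative `(0 1 2 3 4)` of the elements of order `5`. -/
def fiveCycle : alternatingGroup (Fin 5) := ⟨finRotate 5, Perm.mem_alternatingGroup.2 (by decide)⟩

/-- The representative `(0 1 2)` of the elements of order `3`. -/
def threeCycle : alternatingGroup (Fin 5) := ⟨c[0, 1, 2], Perm.mem_alternatingGroup.2 (by decide)⟩

/-- The representative `(0 1)(2 3)` of the elements of order `2`. -/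
def involution : alternatingGroup (Fin 5) :=
  ⟨c[0, 1] * c[2, 3], Perm.mem_alternatingGroup.2 (by decide)⟩

/-- Whether one of the words or pairs of words in two letters that pin down the exponent of the
first one is Hamiltonian. -/
def hasNet (a b : alternatingGroup (Fin 5)) : Bool :=
  anyHamiltonian a b b netWords || anyHamiltonianPair a b b netPairs

theorem isDetecting_of_hasNet (h : hasNet a b = true) : IsDetecting ![a, b, b] := by
  rcases Bool.or_eq_true_iff.1 h with h | h
  · obtain ⟨n, hn, hw⟩ := exists_isHamiltonianWord_of_anyHamiltonian h
    exact isDetecting_of_netWord (List.mem_append_left _ hn) hw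
  · obtain ⟨q, hq, hw₁, hw₂⟩ := exists_isHamiltonianWord_of_anyHamiltonianPair h
    exact isDetecting_of_netPair hq hw₁ hw₂

theorem isDetecting_of_netTriple (h : anyHamiltonianOfType a b c netTriples = true) :
    IsDetecting ![a, b, c] := by
  obtain ⟨n, hn, hw⟩ := exists_isHamiltonianWord_of_anyHamiltonianOfType h
  exact isDetecting_of_netWord (List.mem_append_right _ hn) hw

theorem orderOf_threeCycle : orderOf threeCycle = 3 :=
  orderOf_eq_prime (by decide +kernel) (by decide +kernel)

theorem isDetecting_threeCycle_of_blockCode (hb : b * b = 1)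
    (h : anyHamiltonian threeCycle b b [blockCode] = true) :
    IsDetecting ![threeCycle, b, b] := by
  obtain ⟨n, hn, hw⟩ := exists_isHamiltonianWord_of_anyHamiltonian h
  obtain rfl := List.mem_singleton.1 hn
  exact .inr ⟨orderOf_threeCycle, inv_eq_of_mul_eq_one_left hb, blockSigns, by decide,
    octalWord_blockCode ▸ hw⟩

theorem inv_involution : involution⁻¹ = involution := by decide +kernel

theorem isDetecting_of_anyHamiltonian_flipWords
    (h : anyHamiltonian involution b c flipWords = true) : IsDetecting ![involution, b, c] := by
  obtain ⟨n, hn, hw⟩ := exists_isHamiltonianWord_of_anyHamiltonian h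
  exact isDetecting_of_flipWord inv_involution (List.mem_append_left _ hn) hw

theorem isDetecting_of_anyHamiltonianOfType_flipTriples
    (h : anyHamiltonianOfType involution b c flipTriples = true) :
    IsDetecting ![involution, b, c] := by
  obtain ⟨n, hn, hw⟩ := exists_isHamiltonianWord_of_anyHamiltonianOfType h
  exact isDetecting_of_flipWord inv_involution (List.mem_append_right _ hn) hw

theorem fiveCycle_smul_ne (x : Fin 5) : fiveCycle • x ≠ x := by
  revert x
  decide

theorem hasNet_fiveCycle :
    ∀ b, ConjFixesOrInverts fiveCycle b ∨ hasNet fiveCycle b = true := by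
  decide +kernel

theorem isDetectable_fiveCycle : IsDetectable fiveCycle := by
  intro X hX
  obtain ⟨b, hb, hconj⟩ := exists_mem_not_conjFixesOrInverts hX
    (show fiveCycle * threeCycle ≠ threeCycle * fiveCycle by decide +kernel)
  exact ⟨b, hb, b, hb, isDetecting_of_hasNet ((hasNet_fiveCycle b).resolve_left hconj)⟩

/-- Either `b` has a common fixed point with `(0 1 2)`, or it normalizes the subgroup generated by
`(0 1 2)`. These are the `b` that generate a proper subgroup together with `(0 1 2)`. -/
def FixesOrNormalizes (b : alternatingGroup (Fin 5)) : Prop :=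
  (∃ i ∈ ({3, 4} : Finset (Fin 5)), b • i = i) ∨ ConjFixesOrInverts threeCycle b

instance : DecidablePred FixesOrNormalizes := fun _ => inferInstanceAs (Decidable (_ ∨ _))

theorem fixesOrNormalizes_or_hasNet_or_blockCode :
    ∀ b, FixesOrNormalizes b ∨ hasNet threeCycle b = true ∨
      b * b = 1 ∧ anyHamiltonian threeCycle b b [blockCode] = true := by
  decide +kernel

theorem anyHamiltonianOfType_threeCycle : ∀ i ∈ ({3, 4} : Finset (Fin 5)),
    ∀ d : alternatingGroup (Fin 5), d • i = i → ¬ConjFixesOrInverts threeCycle d →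
      ∀ b, FixesOrNormalizes b → b • i ≠ i →
        anyHamiltonianOfType threeCycle d b netTriples = true := by
  decide +kernel

theorem isDetectable_threeCycle : IsDetectable threeCycle := by
  intro X hX
  by_cases hX' : ∀ b ∈ X, FixesOrNormalizes b
  · obtain ⟨d, hd, hconj⟩ := exists_mem_not_conjFixesOrInverts hX
      (show threeCycle * fiveCycle ≠ fiveCycle * threeCycle by decide +kernel)
    obtain ⟨i, hi, hdi⟩ := (hX' d hd).resolve_right hconj
    obtain ⟨b, hb, hbi⟩ := exists_mem_smul_ne_of_closure_eq_top hX (fiveCycle_smul_ne i)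
    exact ⟨d, hd, b, hb,
      isDetecting_of_netTriple (anyHamiltonianOfType_threeCycle i hi d hdi hconj b (hX' b hb) hbi)⟩
  · push Not at hX'
    obtain ⟨b, hb, hbX⟩ := hX'
    refine ⟨b, hb, b, hb, ?_⟩
    rcases (fixesOrNormalizes_or_hasNet_or_blockCode b).resolve_left hbX with hnet | ⟨hinv, hblock⟩
    · exact isDetecting_of_hasNet hnet
    · exact isDetecting_threeCycle_of_blockCode hinv hblock

/-- Generators of the cyclic subgroups in whose normalizers the elements lie that move `4` but have
no Hamiltonian word from `flipWords` together with `(0 1)(2 3)`. -/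
def flipObstructions : List (alternatingGroup (Fin 5)) :=
  [⟨c[0, 1, 4], Perm.mem_alternatingGroup.2 (by decide)⟩,
    ⟨c[2, 3, 4], Perm.mem_alternatingGroup.2 (by decide)⟩,
    ⟨c[0, 1, 2, 4, 3], Perm.mem_alternatingGroup.2 (by decide)⟩,
    ⟨c[0, 1, 3, 4, 2], Perm.mem_alternatingGroup.2 (by decide)⟩]

theorem conjFixesOrInverts_or_anyHamiltonian_involution :
    ∀ b : alternatingGroup (Fin 5), b • (4 : Fin 5) ≠ 4 →
      (∃ r ∈ flipObstructions, ConjFixesOrInverts r b) ∨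
      anyHamiltonian involution b b flipWords = true := by
  decide +kernel

theorem anyHamiltonian_or_anyHamiltonianOfType_involution :
    ∀ r ∈ flipObstructions, ∀ c, ConjFixesOrInverts r c ∨
      anyHamiltonian involution c c flipWords = true ∨ ∀ b : alternatingGroup (Fin 5),
        b • (4 : Fin 5) ≠ 4 → ConjFixesOrInverts r b →
          anyHamiltonianOfType involution b c flipTriples = true := by
  decide +kernel

theorem flipObstructions_noncommuting :
    ∀ r ∈ flipObstructions, r * fiveCycle ≠ fiveCycle * r := by decide +kernel

theorem isDetectable_involution : IsDetectable involution := by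
  intro X hX
  obtain ⟨b, hb, hb₄⟩ := exists_mem_smul_ne_of_closure_eq_top hX (fiveCycle_smul_ne 4)
  rcases conjFixesOrInverts_or_anyHamiltonian_involution b hb₄ with ⟨r, hr, hrb⟩ | hflip
  · obtain ⟨c, hc, hrc⟩ := exists_mem_not_conjFixesOrInverts hX
      (flipObstructions_noncommuting r hr)
    rcases (anyHamiltonian_or_anyHamiltonianOfType_involution r hr c).resolve_left hrc with
      hflip | htriple
    · exact ⟨c, hc, c, hc, isDetecting_of_anyHamiltonian_flipWords hflip⟩
    · exact ⟨b, hb, c, hc, isDetecting_of_anyHamiltonianOfType_flipTriples (htriple b hb₄ hrb)⟩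
  · exact ⟨b, hb, b, hb, isDetecting_of_anyHamiltonian_flipWords hflip⟩

theorem exists_cycleType_eq : ∀ s : alternatingGroup (Fin 5), s ≠ 1 →
    ∃ r ∈ [fiveCycle, threeCycle, involution],
      (s : Perm (Fin 5)).cycleType = (r : Perm (Fin 5)).cycleType := by
  decide +kernel

theorem isDetectable_of_ne_one {s : alternatingGroup (Fin 5)} (hs : s ≠ 1) : IsDetectable s := by
  obtain ⟨r, hr, hsr⟩ := exists_cycleType_eq s hs
  obtain ⟨τ, hτ⟩ := isConj_iff.1 (Perm.isConj_iff_cycleType_eq.2 hsr)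
  have hφ : (MulAut.conjNormal τ : MulAut (alternatingGroup (Fin 5))) s = r := Subtype.ext hτ
  refine isDetectable_of_map (MulAut.conjNormal τ) (hφ ▸ ?_)
  simp only [List.mem_cons, List.not_mem_nil, or_false] at hr
  rcases hr with rfl | rfl | rfl
  exacts [isDetectable_fiveCycle, isDetectable_threeCycle, isDetectable_involution]

end AlternatingGroupFive

section PrimeOrder

theorem three_le_card_prod {H Z : Type*} [Fintype H] [Fintype Z] [Nonempty H]
    [Fact (Nat.card Z).Prime] (hZ : (Nat.card Z).Coprime 2) : 3 ≤ Fintype.card (H × Z) := by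
  have hne : Nat.card Z ≠ 2 := fun h => absurd (h ▸ hZ) (by decide)
  have htwo : 2 ≤ Nat.card Z := (Fact.out : (Nat.card Z).Prime).two_le
  have hle : Nat.card Z ≤ Nat.card H * Nat.card Z := Nat.le_mul_of_pos_left _ Nat.card_pos
  rw [← Nat.card_eq_fintype_card, Nat.card_prod]
  lia

variable {ι H Z : Type*} [Group H] [CommGroup Z] [Fintype H] [Fintype Z] [DecidableEq H]
  [DecidableEq Z] [Fact (Nat.card Z).Prime] {S : Set (H × Z)} {g : ι → H} {z : ι → Z}

theorem mulCayley_prod_isHamiltonian_of_wordValue_ne_one (hZ : (Nat.card Z).Coprime 2)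
    (hS : ∀ i, (g i, z i) ∈ S) {w : List (ι × Bool)} (hw : IsHamiltonianWord g w)
    (hwz : wordValue z w ≠ 1) : (SimpleGraph.mulCayley S).IsHamiltonian :=
  mulCayley_prod_isHamiltonian_of_zpowers_eq_top (three_le_card_prod hZ) hS hw
    (zpowers_eq_top_of_prime_card rfl hwz)

theorem mulCayley_prod_isHamiltonian_of_one_mem_of_ne_one (hZ : (Nat.card Z).Coprime 2)
    (hH : Even (Nat.card H)) (hS : ∀ i, (g i, z i) ∈ S) {w : List (ι × Bool)}
    (hw : IsHamiltonianWord g w) {ζ : Z} (hζS : (1, ζ) ∈ S) (hζ : ζ ≠ 1) :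
    (SimpleGraph.mulCayley S).IsHamiltonian := by
  by_cases hwz : wordValue z w = 1
  · exact mulCayley_prod_isHamiltonian_of_one_mem (three_le_card_prod hZ) hS hw hwz hH hζS
      (zpowers_eq_top_of_prime_card rfl hζ)
  · exact mulCayley_prod_isHamiltonian_of_wordValue_ne_one hZ hS hw hwz

theorem mulCayley_prod_isHamiltonian_of_single_mem [Finite ι] [DecidableEq ι]
    (hZ : (Nat.card Z).Coprime 2) (hS : ∀ i, (g i, z i) ∈ S) {i : ι} {e : ℕ}
    (hv : Pi.single i (e : ℤ) ∈ cycleLattice g) (he : (Nat.card Z).Coprime e) (hi : z i ≠ 1) :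
    (SimpleGraph.mulCayley S).IsHamiltonian := by
  have hpow : z i ^ (e : ℤ) ≠ 1 := by
    rw [zpow_natCast]
    exact pow_ne_one_of_coprime he hi
  obtain ⟨w, hw, hwz⟩ := exists_wordValue_ne_one_of_single_mem hv hpow
  exact mulCayley_prod_isHamiltonian_of_wordValue_ne_one hZ hS hw hwz

end PrimeOrder

section PrimeOrderDetection

variable {H Z : Type*} [Group H] [CommGroup Z] [Fintype H] [Fintype Z] [DecidableEq H]
  [DecidableEq Z] [Fact (Nat.card Z).Prime] {S : Set (H × Z)} {g : Fin 3 → H} {z : Fin 3 → Z}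

theorem mulCayley_prod_isHamiltonian_of_hasBlockWord (hZ : (Nat.card Z).Coprime (2 * 3))
    (hS : ∀ i, (g i, z i) ∈ S) (hg : HasBlockWord g) (hz : z 0 ≠ 1) :
    (SimpleGraph.mulCayley S).IsHamiltonian := by
  obtain ⟨horder, hinv, signs, hsigns, hw⟩ := hg
  have htwo := hZ.coprime_mul_right_right
  by_cases hz₁ : z 1 = 1
  · exact mulCayley_prod_isHamiltonian_of_blockWord (three_le_card_prod htwo) horder
      hZ.coprime_mul_left_right.symm (zpowers_eq_top_of_prime_card rfl hz) (hS 0) (hz₁ ▸ hS 1) hw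
      hsigns
  · exact mulCayley_prod_isHamiltonian_of_single_mem htwo hS
      (single_two_mem_cycleLattice hinv hw hw.mem_of_blockWord) htwo hz₁

theorem mulCayley_prod_isHamiltonian_of_isDetecting (hZ : (Nat.card Z).Coprime (3 * 1102))
    (hS : ∀ i, (g i, z i) ∈ S) (hg : IsDetecting g) (hz : z 0 ≠ 1) :
    (SimpleGraph.mulCayley S).IsHamiltonian := by
  rcases hg with hlattice | hblock
  · exact mulCayley_prod_isHamiltonian_of_single_mem (hZ.coprime_dvd_right (by norm_num)) hS
      hlattice hZ.coprime_mul_left_right hz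
  · exact mulCayley_prod_isHamiltonian_of_hasBlockWord (hZ.coprime_dvd_right (by norm_num)) hS
      hblock hz

theorem mulCayley_prod_isHamiltonian_of_isDetectable [Nontrivial H] (hH : Even (Nat.card H))
    (hZ : (Nat.card Z).Coprime (3 * 1102)) (hdet : ∀ h : H, h ≠ 1 → IsDetectable h)
    (hS : Subgroup.closure S = ⊤) : (SimpleGraph.mulCayley S).IsHamiltonian := by
  have : Nontrivial Z := Finite.one_lt_card_iff_nontrivial.1 (Fact.out : (Nat.card Z).Prime).one_lt
  obtain ⟨⟨s, ζ⟩, hsS, hζ⟩ := exists_mem_snd_ne_one hS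
  by_cases hs : s = 1
  · subst hs
    obtain ⟨-, ⟨t, ht, rfl⟩, ht₁⟩ :=
      exists_mem_notMem_of_closure_eq_top (closure_image_fst_eq_top hS) (K := ⊥) bot_ne_top
    obtain ⟨g, z, hg, -, hgz⟩ := exists_isDetecting_of_isDetectable hS ht (hdet _ ht₁)
    obtain ⟨w, hw⟩ := hg.exists_isHamiltonianWord
    exact mulCayley_prod_isHamiltonian_of_one_mem_of_ne_one
      (hZ.coprime_dvd_right (by norm_num)) hH hgz hw hsS hζ
  · obtain ⟨g, z, hg, hz, hgz⟩ := exists_isDetecting_of_isDetectable hS hsS (hdet s hs)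
    exact mulCayley_prod_isHamiltonian_of_isDetecting hZ hgz hg (hz ▸ hζ)

end PrimeOrderDetection

theorem mainTheorem1_general {Z : Type*} [CommGroup Z] [Fintype Z] [DecidableEq Z]
    (hprime : (Nat.card Z).Prime) (hexc : Nat.card Z ∉ ({2, 3, 19, 29} : Set ℕ))
    (S : Set (alternatingGroup (Fin 5) × Z)) (hconn : (SimpleGraph.mulCayley S).Connected) :
    (SimpleGraph.mulCayley S).IsHamiltonian := by
  have : Fact (Nat.card Z).Prime := ⟨hprime⟩
  have hcop : (Nat.card Z).Coprime (3 * 1102) := by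
    have hfactor : 3 * 1102 = 2 * 3 * 19 * 29 := rfl
    simp only [Set.mem_insert_iff, Set.mem_singleton_iff, not_or] at hexc
    simp only [hfactor, Nat.coprime_mul_iff_right]
    refine ⟨⟨⟨?_, ?_⟩, ?_⟩, ?_⟩ <;> rw [Nat.coprime_primes hprime (by norm_num)] <;> tauto
  exact mulCayley_prod_isHamiltonian_of_isDetectable (card_alternatingGroup_five ▸ by decide) hcop
    (fun _ => isDetectable_of_ne_one) (closure_eq_top_of_mulCayley_connected hconn)

/-- For a prime `p ≡ 1 (mod 30)` and every subset `S` of `A₅ × ℤ_p` (with `ℤ_p` written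
multiplicatively), if the Cayley graph with respect to `S` is connected, then it has a
hamiltonian cycle. -/
theorem mainTheorem1 (p : ℕ) (hp : p.Prime) (hp30 : p ≡ 1 [MOD 30])
    (S : Set (alternatingGroup (Fin 5) × Multiplicative (ZMod p)))
    (hconn : (SimpleGraph.mulCayley S).Connected) :
    ∃ (v : alternatingGroup (Fin 5) × Multiplicative (ZMod p))
      (C : (SimpleGraph.mulCayley S).Walk v v), C.IsHamiltonianCycle := by
  have : Fact p.Prime := ⟨hp⟩
  have hcard : Nat.card (Multiplicative (ZMod p)) = p := Nat.card_zmod p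
  refine mainTheorem1_general (hcard.symm ▸ hp) (hcard.symm ▸ ?_) S hconn Fintype.one_lt_card.ne'
  rintro (rfl | rfl | rfl | rfl) <;> simp [Nat.ModEq] at hp30
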